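/- **Setting.** Let $K, N, N_r, K_c, M, L$ be positive integers with $N_r \le N$ and $K_c \le K$, and let $\mathbb F_q$ be a finite field. A master wants to compute ${\bf F}W$, where the rows $W_1,\dots,W_K$ of $W \in \mathbb F_q^{K\times L}$ are the messages of $K$ datasets and ${\bf F}\in\mathbb F_q^{K_c\times K}$ is known to the master and to $N$ workers; all entries of ${\bf F}$ and $W$ are independent and uniform over $\mathbb F_q$. A scheme for the $(K,N,N_r,K_c,M)$ distributed linearly separable computation problem consists of - an assignment: each worker $n\in[N]$ gets a set $\mathcal Z_n=\mathcal Z_n({\bf F})\subseteq[K]$ of datasets with $|\mathcal Z_n|\le M$ ($M$ is the computation cost); - encoders: worker $n$ sends $X_n\in\mathbb F_q^{T_n}$, an arbitrary function of $(W_k)_{k\in\mathcal Z_n}$ and ${\bf F}$; - decoders: for each set $\mathcal A\subseteq[N]$ of $N_r$ responding workers, the master computes $\hat g_{\mathcal A}\in\mathbb F_q^{K_c\times L}$, an arbitrary function of $(X_n)_{n\in\mathcal A}$ and ${\bf F}$. Its worst-case error probability is $\varepsilon=\max_{|\mathcal A|=N_r}\Pr\{\hat g_{\mathcal A}\ne {\bf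 F}W\}$ and its communication cost is $\max_{|\mathcal A|=N_r}\sum_{n\in\mathcal A}T_n/L$. A communication cost $R$ is achievable for message length $L$ if there are schemes of communication cost $R$, one over each finite field, with $\varepsilon\to0$ as $q\to\infty$. **Theorem.** Let $K=aN+b$ with integers $a\ge 0$ and $0<b<N$, let $1\le N_r\le N$, $1\le K_c\le K$ and $L\ge1$, and let the computation cost be $$M=M_1:=a(N-N_r+1)+\left\lceil\frac{N-N_r+1}{\lfloor N/b\rfloor}\right\rceil .$$ Then the communication cost $R'_{\rm ach}$ is achievable for message length $L$, where - $R'_{\rm ach}=N_rK_c$ when $1\le K_c\le\lfloor K/N\rfloor$; - $R'_{\rm ach}=\lceil K/N\rceil N_r$ when $\lceil K/N\rceil\le K_c\le\lceil K/N\rceil N_r$; - $R'_{\rm ach}=K_c$ when $\lceil K/N\rceil N_r<K_c\le K$, provided that $L$ is divisible by $\binom{K_c-1}{\lceil K/N\rceil N_r-1}$. -/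

import Mathlib

open scoped NNReal

/-- A computation scheme over the field `𝔽` for the `(K, N, Nr, Kc, M)` distributed linearly
separable computation problem with messages of `L` symbols.

The `K` messages are the rows of a `K × L` matrix `W`, and the master wants `F * W`, where the
`Kc × K` request matrix `F` is known by the master and the workers. -/
structure ComputationScheme (𝔽 : Type) [Field 𝔽] (K N Nr Kc M L : ℕ) where
  /-- Data assignment: the set of datasets assigned to worker `n`. -/
  assign : Fin N → Matrix (Fin Kc) (Fin K) 𝔽 → Finset (Fin K)
  /-- At most `M` datasets are assigned to each worker. -/
  card_assign_le : ∀ n F, (assign n F).card ≤ M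
  /-- The number of symbols sent by worker `n`. -/
  T : Fin N → ℕ
  /-- Computing: the answer of worker `n`, an arbitrary function of the request matrix and of
  the messages of the datasets assigned to this worker. -/
  encode : (n : Fin N) → (F : Matrix (Fin Kc) (Fin K) 𝔽) →
    ({k : Fin K // k ∈ assign n F} → Fin L → 𝔽) → (Fin (T n) → 𝔽)
  /-- Decoding: for each set `A` of `Nr` responding workers, an arbitrary function of the request
  matrix and of the answers of the workers in `A`. -/
  decode : (A : {A : Finset (Fin N) // A.card = Nr}) → Matrix (Fin Kc) (Fin K) 𝔽 →
    ((n : {n : Fin N // n ∈ A.1}) → Fin (T n.1) → 𝔽) → Matrix (Fin Kc) (Fin L) 𝔽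

namespace ComputationScheme

variable {𝔽 : Type} [Field 𝔽] {K N Nr Kc M L : ℕ}

/-- The answer sent by worker `n`. -/
def answer (S : ComputationScheme 𝔽 K N Nr Kc M L) (F : Matrix (Fin Kc) (Fin K) 𝔽)
    (W : Matrix (Fin K) (Fin L) 𝔽) (n : Fin N) : Fin (S.T n) → 𝔽 :=
  S.encode n F (fun k => W k.1)

/-- The master's output when the set of responding workers is `A`. -/
def output (S : ComputationScheme 𝔽 K N Nr Kc M L) (A : {A : Finset (Fin N) // A.card = Nr})
    (F : Matrix (Fin Kc) (Fin K) 𝔽) (W : Matrix (Fin K) (Fin L) 𝔽) :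
    Matrix (Fin Kc) (Fin L) 𝔽 :=
  S.decode A F (fun n => S.answer F W n.1)

/-- The probability that the output differs from `F * W` when the set of responding workers
is `A` and all entries of `F` and `W` are independent and uniform over the finite field `𝔽`. -/
noncomputable def errorProb (S : ComputationScheme 𝔽 K N Nr Kc M L)
    (A : {A : Finset (Fin N) // A.card = Nr}) : ℝ≥0 :=
  (Nat.card {p : Matrix (Fin Kc) (Fin K) 𝔽 × Matrix (Fin K) (Fin L) 𝔽 //
      S.output A p.1 p.2 ≠ p.1 * p.2} : ℝ≥0) /
    (Nat.card (Matrix (Fin Kc) (Fin K) 𝔽 × Matrix (Fin K) (Fin L) 𝔽) : ℝ≥0)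

/-- The worst-case probability of error over all sets of `Nr` responding workers. -/
noncomputable def worstErrorProb (S : ComputationScheme 𝔽 K N Nr Kc M L) : ℝ≥0 :=
  Finset.univ.sup fun A : {A : Finset (Fin N) // A.card = Nr} => S.errorProb A

/-- The communication cost: the maximum, over all sets of `Nr` responding workers, of the
number of received symbols, divided by the message length `L`. -/
def commCost (S : ComputationScheme 𝔽 K N Nr Kc M L) : ℚ :=
  ((Finset.univ.sup fun A : {A : Finset (Fin N) // A.card = Nr} => ∑ n ∈ A.1, S.T n : ℕ) : ℚ) / L

end ComputationScheme

/-- The communication cost `R` is achievable for the `(K, N, Nr, Kc, M)` problem with messages of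
`L` symbols: there are schemes of communication cost `R`, one over each finite field, whose
worst-case probability of error tends to `0` as the order of the field tends to infinity. -/
def IsAchievable (K N Nr Kc M L : ℕ) (R : ℚ) : Prop :=
  ∃ S : (𝔽 : Type) → [Field 𝔽] → [Finite 𝔽] → ComputationScheme 𝔽 K N Nr Kc M L,
    (∀ (𝔽 : Type) [Field 𝔽] [Finite 𝔽], (S 𝔽).commCost = R) ∧
    ∀ δ : ℝ≥0, 0 < δ → ∃ q₀ : ℕ, ∀ (𝔽 : Type) [Field 𝔽] [Finite 𝔽],
      q₀ ≤ Nat.card 𝔽 → (S 𝔽).worstErrorProb ≤ δ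

/-- The computation cost `a (N - Nr + 1) + ⌈(N - Nr + 1) / ⌊N / b⌋⌉`. -/
def computationCost₁ (N Nr a b : ℕ) : ℕ :=
  a * (N - Nr + 1) + (N - Nr + 1) ⌈/⌉ (N / b)

/-! With `r = ⌈K/N⌉`, place the datasets in an `r × N` grid, worker `n` holding the `N - Nr + 1`
cyclically consecutive columns from `n`. Take a matrix with `r * Nr` rows over the grid. A
combination of its rows that vanishes off the window of `n` satisfies `r * (Nr - 1)` equations, so
generically these form an `r`-dimensional space. For `Nr` workers the dimensions add up to `r * Nr`,
and generically the spaces span everything, so `r` combinations per worker determine all the rows.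
Both facts say that one square matrix, `spreadMatrix`, is invertible. Its determinant is a nonzero
polynomial, by specialization to rows supported on windows (`exists_spreadMatrix_injective`), so
Schwartz-Zippel bounds the failures by `C / q`.

For few requests, each one is computed separately by rescaling a fixed generic row, as in gradient
coding. For intermediate `Kc`, the request matrix is padded to `r * Nr` rows. For large `Kc`, the
code is used for every set of `r * Nr` rows, on Vandermonde combinations of message pieces, with as
many pieces as there are sets containing a given row. -/

/-! ### Linear schemes and their error probability -/

/-- The workers, holding the datasets `Z n`, can send linear combinations of their messages,
indexed by `τ`, such that the combinations sent by any `Nr` workers determine `F * W`. -/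
def IsLinearlyComputable {𝔽 : Type} [Field 𝔽] {K N Kc : ℕ} (Nr L : ℕ) (Z : Fin N → Finset (Fin K))
    (τ : Type) (F : Matrix (Fin Kc) (Fin K) 𝔽) : Prop :=
  ∃ enc : Fin N → Matrix (Fin K) (Fin L) 𝔽 →ₗ[𝔽] (τ → 𝔽),
    (∀ n W, (∀ k ∈ Z n, W k = 0) → enc n W = 0) ∧
    ∀ A : Finset (Fin N), A.card = Nr → ∀ W, (∀ n ∈ A, enc n W = 0) → F * W = 0

namespace ComputationScheme

variable {𝔽 : Type} [Field 𝔽] {K N Nr Kc M L : ℕ}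

open Classical in
/-- The scheme with data assignment `Z` in which each worker sends `T` linear combinations that
allow the computation of `F * W` whenever there are such combinations. -/
noncomputable def ofAssignment (Z : Fin N → Finset (Fin K)) (hZ : ∀ n, (Z n).card ≤ M) (T : ℕ) :
    ComputationScheme 𝔽 K N Nr Kc M L where
  assign n _ := Z n
  card_assign_le n _ := hZ n
  T _ := T
  encode n F w :=
    if h : IsLinearlyComputable Nr L Z (Fin T) F then
      h.choose n (Matrix.of fun k => if hk : k ∈ Z n then w ⟨k, hk⟩ else 0) else 0
  decode A F x :=
    if h : IsLinearlyComputable Nr L Z (Fin T) F then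
      if hW : ∃ W : Matrix (Fin K) (Fin L) 𝔽, ∀ n : {n : Fin N // n ∈ A.1}, h.choose n.1 W = x n
      then F * hW.choose else 0 else 0

theorem output_ofAssignment (Z : Fin N → Finset (Fin K)) (hZ : ∀ n, (Z n).card ≤ M) (T : ℕ)
    (A : {A : Finset (Fin N) // A.card = Nr}) (F : Matrix (Fin Kc) (Fin K) 𝔽)
    (hF : IsLinearlyComputable Nr L Z (Fin T) F) (W : Matrix (Fin K) (Fin L) 𝔽) :
    (ofAssignment Z hZ T : ComputationScheme 𝔽 K N Nr Kc M L).output A F W = F * W := by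
  classical
  have hans : ∀ n, (ofAssignment Z hZ T : ComputationScheme 𝔽 K N Nr Kc M L).answer F W n
      = hF.choose n W := by
    intro n
    simp only [answer, ofAssignment, dif_pos hF]
    -- Replacing the rows not held by zero changes `W` only outside `Z n`, which the encoder
    -- ignores.
    refine sub_eq_zero.1 ((map_sub (hF.choose n) _ _).symm.trans
      (hF.choose_spec.1 n _ fun k hk => ?_))
    funext l
    simp [hk]
  have hW : ∃ W' : Matrix (Fin K) (Fin L) 𝔽, ∀ n : {n : Fin N // n ∈ A.1},
      hF.choose n.1 W'
        = (ofAssignment Z hZ T : ComputationScheme 𝔽 K N Nr Kc M L).answer F W n.1 :=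
    ⟨W, fun n => (hans n.1).symm⟩
  have hout : (ofAssignment Z hZ T : ComputationScheme 𝔽 K N Nr Kc M L).output A F W
      = F * hW.choose := by
    unfold output
    simp only [ofAssignment, dif_pos hF]
    exact dif_pos hW
  -- The decoder may pick any message matrix consistent with the answers: its difference from `W` is
  -- killed by the encoders of `A`, hence by `F`.
  rw [hout, ← sub_eq_zero, ← Matrix.mul_sub]
  refine hF.choose_spec.2 A.1 A.2 _ fun n hn => ?_
  rw [map_sub, sub_eq_zero, ← hans n]
  exact hW.choose_spec ⟨n, hn⟩

/-- An error can occur only at a bad `F`, whatever `W` is, so the count of bad pairs is at most the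
count of bad `F` times that of all `W`. -/
theorem errorProb_ofAssignment_le [Finite 𝔽] (Z : Fin N → Finset (Fin K))
    (hZ : ∀ n, (Z n).card ≤ M) (T C : ℕ)
    (h : Nat.card {F : Matrix (Fin Kc) (Fin K) 𝔽 // ¬ IsLinearlyComputable Nr L Z (Fin T) F} *
      Nat.card 𝔽 ≤ C * Nat.card (Matrix (Fin Kc) (Fin K) 𝔽))
    (A : {A : Finset (Fin N) // A.card = Nr}) :
    (ofAssignment Z hZ T : ComputationScheme 𝔽 K N Nr Kc M L).errorProb A ≤ C / Nat.card 𝔽 := by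
  have : Finite (Matrix (Fin Kc) (Fin K) 𝔽) := inferInstanceAs (Finite (Fin Kc → Fin K → 𝔽))
  have : Finite (Matrix (Fin K) (Fin L) 𝔽) := inferInstanceAs (Finite (Fin K → Fin L → 𝔽))
  have hle : Nat.card {p : Matrix (Fin Kc) (Fin K) 𝔽 × Matrix (Fin K) (Fin L) 𝔽 //
      (ofAssignment Z hZ T : ComputationScheme 𝔽 K N Nr Kc M L).output A p.1 p.2 ≠ p.1 * p.2} ≤
      Nat.card {F : Matrix (Fin Kc) (Fin K) 𝔽 // ¬ IsLinearlyComputable Nr L Z (Fin T) F} *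
        Nat.card (Matrix (Fin K) (Fin L) 𝔽) := by
    rw [← Nat.card_prod]
    refine Nat.card_le_card_of_injective
      (fun p => (⟨p.1.1, fun hF => p.2 (output_ofAssignment Z hZ T A _ hF _)⟩, p.1.2)) ?_
    rintro ⟨⟨F, W⟩, _⟩ ⟨⟨F', W'⟩, _⟩ h
    simpa using h
  have h𝔽 : 0 < Nat.card 𝔽 := Nat.card_pos
  have hM : 0 < Nat.card (Matrix (Fin Kc) (Fin K) 𝔽 × Matrix (Fin K) (Fin L) 𝔽) := Nat.card_pos
  unfold errorProb
  rw [div_le_div_iff₀ (by exact_mod_cast hM) (by exact_mod_cast h𝔽)]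
  norm_cast
  rw [Nat.card_prod]
  calc _ ≤ _ := Nat.mul_le_mul_right _ hle
    _ = Nat.card {F : Matrix (Fin Kc) (Fin K) 𝔽 // ¬ IsLinearlyComputable Nr L Z (Fin T) F} *
      Nat.card 𝔽 * Nat.card (Matrix (Fin K) (Fin L) 𝔽) := by ring
    _ ≤ _ := Nat.mul_le_mul_right _ h
    _ = _ := by ring

theorem commCost_ofAssignment (Z : Fin N → Finset (Fin K)) (hZ : ∀ n, (Z n).card ≤ M) (T R : ℕ)
    (hNr : Nr ≤ N) (hL : 0 < L) (hT : Nr * T = R * L) :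
    (ofAssignment Z hZ T : ComputationScheme 𝔽 K N Nr Kc M L).commCost = R := by
  -- A responding set must exist, since the supremum over none would be `0`.
  obtain ⟨A, -, hA⟩ := Finset.exists_subset_card_eq (s := (Finset.univ : Finset (Fin N)))
    (n := Nr) (by simpa using hNr)
  have hsup : (Finset.univ.sup fun A : {A : Finset (Fin N) // A.card = Nr} =>
      ∑ n ∈ A.1, (ofAssignment Z hZ T : ComputationScheme 𝔽 K N Nr Kc M L).T n) = R * L := by
    have hconst : (fun A : {A : Finset (Fin N) // A.card = Nr} =>
        ∑ n ∈ A.1, (ofAssignment Z hZ T : ComputationScheme 𝔽 K N Nr Kc M L).T n)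
        = fun _ => R * L := by
      funext A
      simp [ofAssignment, A.2, hT]
    rw [hconst, Finset.sup_const ⟨⟨A, hA⟩, Finset.mem_univ _⟩]
  unfold commCost
  rw [hsup]
  have : (L : ℚ) ≠ 0 := by positivity
  push_cast
  field_simp

end ComputationScheme

theorem isAchievable_of_isLinearlyComputable {K N Nr Kc M L : ℕ} (Z : Fin N → Finset (Fin K))
    (hZ : ∀ n, (Z n).card ≤ M) (τ : Type) [Fintype τ] (R C : ℕ) (hNr : Nr ≤ N) (hL : 0 < L)
    (hT : Nr * Fintype.card τ = R * L)
    (h : ∀ (𝔽 : Type) [Field 𝔽] [Finite 𝔽],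
      Nat.card {F : Matrix (Fin Kc) (Fin K) 𝔽 // ¬ IsLinearlyComputable Nr L Z τ F} *
        Nat.card 𝔽 ≤ C * Nat.card (Matrix (Fin Kc) (Fin K) 𝔽)) :
    IsAchievable K N Nr Kc M L R := by
  have hτ : ∀ (𝔽 : Type) [Field 𝔽] (F : Matrix (Fin Kc) (Fin K) 𝔽),
      IsLinearlyComputable Nr L Z τ F → IsLinearlyComputable Nr L Z (Fin (Fintype.card τ)) F := by
    rintro 𝔽 _ F ⟨enc, h₁, h₂⟩
    let e := LinearEquiv.funCongrLeft 𝔽 𝔽 (Fintype.equivFin τ).symm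
    refine ⟨fun n => e.toLinearMap ∘ₗ enc n, fun n W hW => ?_, fun A hA W hW => ?_⟩
    · simp [h₁ n W hW]
    · exact h₂ A hA W fun n hn => by simpa using hW n hn
  refine ⟨fun 𝔽 _ _ => ComputationScheme.ofAssignment Z hZ (Fintype.card τ), fun 𝔽 _ _ =>
    ComputationScheme.commCost_ofAssignment Z hZ _ R hNr hL hT, fun δ hδ => ?_⟩
  obtain ⟨q₀, hq₀⟩ := exists_nat_ge ((C : ℝ≥0) / δ)
  refine ⟨q₀, fun 𝔽 _ _ hq => Finset.sup_le fun A _ => ?_⟩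
  have : Finite (Matrix (Fin Kc) (Fin K) 𝔽) := inferInstanceAs (Finite (Fin Kc → Fin K → 𝔽))
  refine (ComputationScheme.errorProb_ofAssignment_le Z hZ _ C
    ((Nat.mul_le_mul_right _ ?_).trans (h 𝔽)) A).trans ?_
  · exact Nat.card_le_card_of_injective (fun F => ⟨F.1, fun hF => F.2 (hτ 𝔽 _ hF)⟩)
      fun F F' h => Subtype.ext (by simpa using h)
  · have h𝔽 : (0 : ℝ≥0) < Nat.card 𝔽 := by exact_mod_cast Nat.card_pos
    rw [div_le_iff₀ h𝔽]
    rw [div_le_iff₀ hδ] at hq₀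
    calc (C : ℝ≥0) ≤ q₀ * δ := hq₀
      _ ≤ Nat.card 𝔽 * δ := by gcongr
      _ = δ * Nat.card 𝔽 := mul_comm _ _

/-! ### Counting bad vectors over a finite field -/

/-- The **Schwartz-Zippel lemma** over a finite field. -/
theorem card_eval_eq_zero_mul_card_le {𝔽 σ : Type} [Field 𝔽] [Finite 𝔽] [Finite σ]
    (p : MvPolynomial σ 𝔽) (hp : p ≠ 0) (d : ℕ) (hd : p.totalDegree ≤ d) :
    Nat.card {f : σ → 𝔽 // MvPolynomial.eval f p = 0} * Nat.card 𝔽 ≤ d * Nat.card (σ → 𝔽) := by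
  classical
  have := Fintype.ofFinite 𝔽
  have := Fintype.ofFinite σ
  let e := Fintype.equivFin σ
  have hinj : Function.Injective (MvPolynomial.rename e : MvPolynomial σ 𝔽 → _) :=
    MvPolynomial.rename_injective _ e.injective
  have hsz := MvPolynomial.schwartz_zippel_totalDegree
    (p := MvPolynomial.rename e p) ((map_ne_zero_iff _ hinj).2 hp) Finset.univ
  have hcard : Nat.card {f : σ → 𝔽 // MvPolynomial.eval f p = 0}
      = (Finset.univ.filter fun f : Fin (Fintype.card σ) → 𝔽 =>
          MvPolynomial.eval f (MvPolynomial.rename e p) = 0).card := by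
    rw [← Fintype.card_subtype, ← Nat.card_eq_fintype_card]
    refine Nat.card_congr ((Equiv.arrowCongr e (Equiv.refl 𝔽)).subtypeEquiv fun f => ?_)
    rw [MvPolynomial.eval_rename]
    congr! 3
    funext i
    simp
  rw [Fintype.piFinset_univ, ← hcard] at hsz
  replace hsz := hsz.trans (div_le_div_of_nonneg_right
    (Nat.cast_le.2 ((MvPolynomial.totalDegree_rename_le e p).trans hd)) (by positivity))
  have hq : 0 < Fintype.card 𝔽 := Fintype.card_pos
  rw [Finset.card_univ, div_le_div_iff₀ (by positivity) (by positivity)] at hsz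
  norm_cast at hsz
  rw [Nat.card_eq_fintype_card (α := 𝔽), Nat.card_eq_fintype_card (α := σ → 𝔽), Fintype.card_fun]
  exact hsz

/-- If a property fails for at most a fraction `c / q` of all vectors, then at most a fraction
`c / q` of the vectors in fewer coordinates cannot be extended to a vector with the property. -/
theorem card_not_exists_extension_mul_le {𝔽 α β : Type} [Finite 𝔽] [Nonempty 𝔽] [Finite β]
    (j : α → β) (hj : Function.Injective j) (P : (β → 𝔽) → Prop) (q c : ℕ)
    (h : Nat.card {g : β → 𝔽 // ¬ P g} * q ≤ c * Nat.card (β → 𝔽)) :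
    Nat.card {f : α → 𝔽 // ¬ ∃ g, g ∘ j = f ∧ P g} * q ≤ c * Nat.card (α → 𝔽) := by
  classical
  have : Finite α := Finite.of_injective j hj
  let B := {b : β // ¬ b ∈ Set.range j}
  let e : (β → 𝔽) ≃ (α → 𝔽) × (B → 𝔽) :=
    (Equiv.piEquivPiSubtypeProd (· ∈ Set.range j) fun _ => 𝔽).trans
      (Equiv.prodCongr (Equiv.arrowCongr (Equiv.ofInjective j hj).symm (Equiv.refl 𝔽))
        (Equiv.refl _))
  have he : ∀ f u, (e.symm (f, u)) ∘ j = f := by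
    intro f u
    have h1 : ∀ g, (e g).1 = g ∘ j := fun g => by
      funext a
      simp [e]
    rw [← h1, Equiv.apply_symm_apply]
  -- Every extension of a bad `f` violates `P`, and each `f` has `Nat.card (B → 𝔽)` extensions.
  have hle : Nat.card {f : α → 𝔽 // ¬ ∃ g, g ∘ j = f ∧ P g} * Nat.card (B → 𝔽)
      ≤ Nat.card {g : β → 𝔽 // ¬ P g} := by
    rw [← Nat.card_prod]
    refine Nat.card_le_card_of_injective
      (fun p => ⟨e.symm (p.1.1, p.2), fun hP => p.1.2 ⟨_, he _ _, hP⟩⟩) ?_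
    rintro ⟨⟨f, _⟩, u⟩ ⟨⟨f', _⟩, u'⟩ h
    simpa using h
  have hB : 0 < Nat.card (B → 𝔽) := Nat.card_pos
  rw [Nat.card_congr e, Nat.card_prod] at h
  refine Nat.le_of_mul_le_mul_right ?_ hB
  calc _ = Nat.card {f : α → 𝔽 // ¬ ∃ g, g ∘ j = f ∧ P g} * Nat.card (B → 𝔽) * q := by ring
    _ ≤ _ := Nat.mul_le_mul_right _ hle
    _ ≤ _ := h
    _ = _ := by ring

/-! ### Cyclic windows and the matching of workers with positions -/

/-- The positions assigned to worker `n` in the cyclic assignment: `N - Nr + 1` consecutive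
positions starting from `n`. -/
def cyclicWindow (N Nr : ℕ) (n : Fin N) : Finset (Fin N) :=
  Finset.univ.filter fun p => (p - n).val ≤ N - Nr

theorem mem_cyclicWindow {N Nr : ℕ} {n p : Fin N} :
    p ∈ cyclicWindow N Nr n ↔ (p - n).val ≤ N - Nr := by
  simp [cyclicWindow]

theorem card_cyclicWindow {N Nr : ℕ} (h₁ : 1 ≤ Nr) (h₂ : Nr ≤ N) (n : Fin N) :
    (cyclicWindow N Nr n).card = N - Nr + 1 := by
  have : NeZero N := ⟨by omega⟩
  have h : (cyclicWindow N Nr n).map (Equiv.subRight n).toEmbedding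
      = Finset.univ.filter fun d : Fin N => d.val < N - Nr + 1 := by
    ext d
    simp [mem_cyclicWindow]
  rw [← Finset.card_map, h, Fin.card_filter_val_lt]
  omega

theorem card_notMem_cyclicWindow {N Nr : ℕ} (h₁ : 1 ≤ Nr) (h₂ : Nr ≤ N) (n : Fin N) :
    Fintype.card {p // p ∉ cyclicWindow N Nr n} = Nr - 1 := by
  rw [Fintype.card_subtype_compl, Fintype.card_coe, card_cyclicWindow h₁ h₂, Fintype.card_fin]
  omega

theorem Fin.val_sub_eq_of_le {N : ℕ} [NeZero N] (n m p : Fin N)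
    (h : (m - n).val ≤ (p - n).val) : (p - m).val = (p - n).val - (m - n).val := by
  have h' : p - m = (p - n) - (m - n) := by abel
  rw [h', Fin.sub_val_of_le (by exact_mod_cast h)]

/-- A worker of `A` being excluded, the positions that it does not hold can be matched with the
other workers of `A`, each of them holding its position. -/
theorem exists_equiv_cyclicWindow {N Nr : ℕ} (A : Finset (Fin N)) (hA : A.card = Nr)
    (hNrN : Nr ≤ N) (n : A) :
    ∃ τ : {m : A // m ≠ n} ≃ {p // p ∉ cyclicWindow N Nr n}, ∀ m,
      (τ m).1 ∈ cyclicWindow N Nr m.1 := by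
  have hNr : 1 ≤ Nr := hA ▸ Finset.card_pos.2 ⟨n, n.2⟩
  have : NeZero N := ⟨by omega⟩
  let d : Fin N → ℕ := fun m => (m - n.1).val
  have hd : Function.Injective d := fun x y h => by simpa [d, Fin.val_inj] using h
  -- For `m` in `A`, `i m` is its rank in the cyclic order starting at `n`, which has rank `0`.
  -- Worker `m` will get the position at distance `N - Nr + i m` from `n`, just beyond the window of
  -- `n` for rank `1`.
  let i : Fin N → ℕ := fun m => (A.filter fun m' => d m' < d m).card
  have hi_lt : ∀ m ∈ A, ∀ m', d m < d m' → i m < i m' := by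
    intro m hm m' h
    refine Finset.card_lt_card ⟨fun x hx => ?_, fun hs => ?_⟩
    · simp only [Finset.mem_filter] at hx ⊢
      exact ⟨hx.1, hx.2.trans h⟩
    · have := hs (Finset.mem_filter.2 ⟨hm, h⟩)
      simp at this
  have hi_le : ∀ m, i m ≤ d m := by
    intro m
    have : i m ≤ (Finset.range (d m)).card :=
      Finset.card_le_card_of_injOn d (by intro x hx; simpa using (Finset.mem_filter.1 hx).2)
        hd.injOn
    simpa using this
  have hi_pos : ∀ m : A, m ≠ n → 0 < i m := by
    intro m hm
    refine Finset.card_pos.2 ⟨n, Finset.mem_filter.2 ⟨n.2, ?_⟩⟩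
    have h0 : d n = 0 := by simp [d]
    have : d m ≠ d n := fun h => hm (Subtype.ext (hd h))
    omega
  -- The `Nr - i m` workers of `A` not before `m` have distinct distances in `[d m, N)`. This puts
  -- the matched position at or after `m`, while `hi_le` keeps it within the window of `m`.
  have hi_ge : ∀ m ∈ A, Nr ≤ i m + (N - d m) := by
    intro m hm
    have h1 : (A.filter fun m' => ¬ d m' < d m).card ≤ (Finset.Ico (d m) N).card :=
      Finset.card_le_card_of_injOn d (by
        intro x hx
        have := (Finset.mem_filter.1 hx).2
        simp only [Finset.coe_Ico, Set.mem_Ico]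
        exact ⟨by omega, (x - n.1).isLt⟩) hd.injOn
    have h2 := Finset.card_filter_add_card_filter_not (s := A) fun m' => d m' < d m
    rw [Nat.card_Ico] at h1
    rw [hA] at h2
    simp only [i]
    omega
  have hi_N : ∀ m ∈ A, i m < Nr := by
    intro m hm
    rw [← hA]
    refine Finset.card_lt_card ⟨Finset.filter_subset _ _, fun hs => ?_⟩
    have := hs hm
    simp at this
  let t : {m : A // m ≠ n} → Fin N := fun m => Fin.ofNat N (N - Nr + i m.1) + n.1
  have ht : ∀ m, (t m - n.1).val = N - Nr + i m.1 := by
    intro m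
    have := hi_N m.1 m.1.2
    simp only [t, add_sub_cancel_right, Fin.ofNat, Nat.mod_eq_of_lt (show N - Nr + i m.1 < N by omega)]
  have htn : ∀ m, t m ∉ cyclicWindow N Nr n := by
    intro m
    rw [mem_cyclicWindow, ht]
    have := hi_pos m.1 m.2
    omega
  let τ : {m : A // m ≠ n} → {p // p ∉ cyclicWindow N Nr n} := fun m => ⟨t m, htn m⟩
  have hτ : Function.Bijective τ := by
    rw [Fintype.bijective_iff_injective_and_card]
    constructor
    · intro m m' h
      have h1 : t m = t m' := congrArg Subtype.val h
      have h2 : i m.1 = i m'.1 := by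
        have := ht m
        rw [h1, ht] at this
        omega
      refine Subtype.ext (Subtype.ext (hd ?_))
      by_contra hne
      rcases lt_or_gt_of_ne hne with hlt | hlt
      · exact absurd (hi_lt _ m.1.2 _ hlt) (by omega)
      · exact absurd (hi_lt _ m'.1.2 _ hlt) (by omega)
    · rw [card_notMem_cyclicWindow hNr hNrN, Fintype.card_subtype_compl, Fintype.card_coe, hA]
      simp
  refine ⟨Equiv.ofBijective τ hτ, fun m => ?_⟩
  change t m ∈ _
  have h1 := hi_le m.1
  have h2 := hi_ge m.1 m.1.2
  have h3 := (m.1.1 - n.1).isLt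
  have h4 := ht m
  simp only [d] at h1 h2
  rw [mem_cyclicWindow, Fin.val_sub_eq_of_le n.1 m.1.1 (t m) (by omega), h4]
  omega

/-! ### Spread matrices and genericity -/

open Matrix MvPolynomial

/-- The matrix of the map that sends a family `y` of vectors indexed by the workers in `A` to the
pair of `∑ n, y n` and of the entries of `y n ᵥ* G` at the positions not held by worker `n`. -/
def spreadMatrix {R ρ : Type} [CommRing R] [DecidableEq ρ] {r N : ℕ} (Nr : ℕ) (A : Finset (Fin N))
    (G : Matrix ρ (Fin r × Fin N) R) :
    Matrix (ρ ⊕ (Σ n : A, {x : Fin r × Fin N // x.2 ∉ cyclicWindow N Nr n})) (A × ρ) R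
  | .inl i, q => if i = q.2 then 1 else 0
  | .inr x, q => if x.1 = q.1 then G q.2 x.2 else 0

section spreadMatrix

variable {R ρ : Type} [CommRing R] [DecidableEq ρ] [Fintype ρ] {r N Nr : ℕ} {A : Finset (Fin N)}

theorem spreadMatrix_mulVec_inl (G : Matrix ρ (Fin r × Fin N) R) (y : A × ρ → R) (i : ρ) :
    (spreadMatrix Nr A G *ᵥ y) (.inl i) = ∑ n, y (n, i) := by
  simp [mulVec, dotProduct, spreadMatrix, Fintype.sum_prod_type]

theorem spreadMatrix_mulVec_inr (G : Matrix ρ (Fin r × Fin N) R) (y : A × ρ → R) (n : A)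
    (x : {x : Fin r × Fin N // x.2 ∉ cyclicWindow N Nr n}) :
    (spreadMatrix Nr A G *ᵥ y) (.inr ⟨n, x⟩) = ∑ i, G i x * y (n, i) := by
  simp only [mulVec, dotProduct, spreadMatrix, Fintype.sum_prod_type]
  rw [Finset.sum_eq_single n]
  · simp
  · intro m _ hm
    simp [hm.symm]
  · simp

omit [Fintype ρ] in
theorem spreadMatrix_map {R' : Type} [CommRing R'] (f : R →+* R')
    (G : Matrix ρ (Fin r × Fin N) R) :
    (spreadMatrix Nr A G).map f = spreadMatrix Nr A (G.map f) := by
  ext (i | x) q <;> simp only [map_apply, spreadMatrix] <;> split_ifs <;> simp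

theorem card_uncovered (hNr : 1 ≤ Nr) (hNrN : Nr ≤ N) (n : Fin N) :
    Fintype.card {x : Fin r × Fin N // x.2 ∉ cyclicWindow N Nr n} = r * (Nr - 1) := by
  have e : {x : Fin r × Fin N // x.2 ∉ cyclicWindow N Nr n} ≃
      Fin r × {p // p ∉ cyclicWindow N Nr n} :=
    ⟨fun x => (x.1.1, ⟨x.1.2, x.2⟩), fun x => ⟨(x.1, x.2.1), x.2.2⟩, fun _ => rfl, fun _ => rfl⟩
  rw [Fintype.card_congr e, Fintype.card_prod, Fintype.card_fin,
    card_notMem_cyclicWindow hNr hNrN]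

omit [DecidableEq ρ] in
-- The spread matrix is square because `r * Nr + Nr * (r * (Nr - 1)) = Nr * (r * Nr)`; hence
-- injectivity at one specialization yields generic surjectivity.
theorem card_spreadMatrix_rows (hρ : Fintype.card ρ = r * Nr) (hA : A.card = Nr) (hNr : 1 ≤ Nr)
    (hNrN : Nr ≤ N) :
    Fintype.card (ρ ⊕ (Σ n : A, {x : Fin r × Fin N // x.2 ∉ cyclicWindow N Nr n}))
      = Fintype.card (A × ρ) := by
  rw [Fintype.card_sum, Fintype.card_sigma, Fintype.card_prod, Fintype.card_coe, hA, hρ]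
  simp_rw [card_uncovered hNr hNrN]
  rw [Finset.sum_const, Finset.card_univ, Fintype.card_coe, hA, smul_eq_mul]
  obtain ⟨k, rfl⟩ : ∃ k, Nr = k + 1 := ⟨Nr - 1, by omega⟩
  rw [Nat.add_sub_cancel]
  ring

end spreadMatrix

/-- A square matrix with variables at the positions of a pattern is nonsingular if the pattern
contains the diagonal. -/
theorem det_pattern_ne_zero {𝔽 ι ρ γ : Type} [Field 𝔽] [Fintype ι] [DecidableEq ι]
    (w : ρ → γ → Prop) [∀ i x, Decidable (w i x)] (f : ι → ρ) (c : ι → γ)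
    (hf : Function.Injective f) (hc : Function.Injective c) (hw : ∀ i, w (f i) (c i)) :
    (of fun i i' => if w (f i') (c i) then (X (f i', c i) : MvPolynomial (ρ × γ) 𝔽) else 0).det
      ≠ 0 := by
  classical
  intro h0
  -- At this point the matrix becomes the identity.
  let pt : ρ × γ → 𝔽 := fun q => if ∃ i, f i = q.1 ∧ c i = q.2 then 1 else 0
  have h := congrArg (eval pt) h0
  rw [RingHom.map_det, map_zero] at h
  refine one_ne_zero (α := 𝔽) (Eq.trans ?_ h)
  rw [← det_one (n := ι)]
  congr 1
  ext i i'
  rw [RingHom.mapMatrix_apply, map_apply, of_apply, one_apply, apply_ite (eval pt), eval_X,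
    map_zero]
  have hpt : pt (f i', c i) = if i = i' then 1 else 0 := by
    refine if_congr ⟨?_, ?_⟩ rfl rfl
    · rintro ⟨k, h₁, h₂⟩
      rw [← hc h₂, hf h₁]
    · rintro rfl
      exact ⟨i, rfl, rfl⟩
  rcases eq_or_ne i i' with rfl | hne
  · rw [if_pos (hw i), hpt]
  · rw [hpt, if_neg hne, ite_self]

theorem exists_injective_uncovered {ρ : Type} {r N Nr : ℕ} (A : Finset (Fin N))
    (e : ρ ≃ Fin r × A) (hA : A.card = Nr) (hNrN : Nr ≤ N) (n : A) :
    ∃ c : {i // (e i).2 ≠ n} → Fin r × Fin N, Function.Injective c ∧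
      ∀ i, (c i).2 ∉ cyclicWindow N Nr n ∧ (c i).2 ∈ cyclicWindow N Nr (e i).2 := by
  obtain ⟨τ, hτ⟩ := exists_equiv_cyclicWindow A hA hNrN n
  refine ⟨fun i => ((e i.1).1, (τ ⟨(e i.1).2, i.2⟩).1), fun i i' h => ?_,
    fun i => ⟨(τ ⟨(e i.1).2, i.2⟩).2, hτ ⟨(e i.1).2, i.2⟩⟩⟩
  obtain ⟨h1, h2⟩ := Prod.mk.inj h
  have h3 : (e i.1).2 = (e i'.1).2 := congrArg Subtype.val (τ.injective (Subtype.ext h2))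
  exact Subtype.ext (e.injective (Prod.ext h1 h3))

/-- There is a matrix of polynomials with an injective spread matrix: its row associated with a
block and a worker vanishes exactly at the positions not held by the worker. -/
theorem exists_spreadMatrix_injective (𝔽 : Type) [Field 𝔽] {ρ : Type} [DecidableEq ρ] [Fintype ρ]
    {r N Nr : ℕ} (A : Finset (Fin N)) (hρ : Fintype.card ρ = r * Nr) (hA : A.card = Nr)
    (hNrN : Nr ≤ N) :
    ∃ G : Matrix ρ (Fin r × Fin N) (MvPolynomial (ρ × (Fin r × Fin N)) 𝔽),
      ∀ y, spreadMatrix Nr A G *ᵥ y = 0 → y = 0 := by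
  classical
  let e : ρ ≃ Fin r × A := Fintype.equivOfCardEq (by simp [hρ, hA])
  let G : Matrix ρ (Fin r × Fin N) (MvPolynomial (ρ × (Fin r × Fin N)) 𝔽) :=
    fun i x => if x.2 ∈ cyclicWindow N Nr (e i).2 then X (i, x) else 0
  refine ⟨G, fun y hy => ?_⟩
  have hoff : ∀ (n : A) (i : ρ), (e i).2 ≠ n → y (n, i) = 0 := by
    intro n
    obtain ⟨c, hc, hcn⟩ := exists_injective_uncovered A e hA hNrN n
    have hB := det_pattern_ne_zero (𝔽 := 𝔽) (fun i x => x.2 ∈ cyclicWindow N Nr (e i).2)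
      (Subtype.val : {i // (e i).2 ≠ n} → ρ) c Subtype.val_injective hc fun i => (hcn i).2
    -- The rows associated with `n` vanish at the positions that `n` does not hold, so only the
    -- coefficients of the other rows enter these equations.
    have hker : (of fun i i' : {i // (e i).2 ≠ n} => G i' (c i)) *ᵥ (fun i => y (n, i.1)) = 0 := by
      funext i
      have h := congrFun hy (.inr ⟨n, c i, (hcn i).1⟩)
      rw [spreadMatrix_mulVec_inr,
        ← Fintype.sum_subtype_add_sum_subtype (fun i => (e i).2 ≠ n),
        Finset.sum_eq_zero (s := (Finset.univ : Finset {i // ¬ (e i).2 ≠ n})), add_zero] at h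
      · exact h
      · intro i' _
        have hi' : (e i'.1).2 = n := not_not.1 i'.2
        simp only [G, hi', if_neg (hcn i).1, zero_mul]
    have hzero : (fun i : {i // (e i).2 ≠ n} => y (n, i.1)) = 0 := by
      by_contra hne
      exact hB (exists_mulVec_eq_zero_iff.1 ⟨_, hne, hker⟩)
    exact fun i hi => congrFun hzero ⟨i, hi⟩
  funext ⟨n, i⟩
  by_cases h : (e i).2 = n
  -- The only term left in `∑ m, y (m, i) = 0` is the one of the worker associated with row `i`.
  · have hs := congrFun hy (.inl i)
    rw [spreadMatrix_mulVec_inl, Finset.sum_eq_single n (fun m _ hm => hoff m i (h ▸ hm.symm))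
      (by simp)] at hs
    exact hs
  · exact hoff n i h

theorem MvPolynomial.totalDegree_det_le {σ ι R : Type} [CommRing R] [Fintype ι] [DecidableEq ι]
    (B : Matrix ι ι (MvPolynomial σ R)) (h : ∀ i j, (B i j).totalDegree ≤ 1) :
    B.det.totalDegree ≤ Fintype.card ι := by
  rw [det_apply]
  refine totalDegree_finsetSum_le fun s _ => ?_
  have hprod : (∏ i, B (s i) i).totalDegree ≤ Fintype.card ι := by
    refine (totalDegree_finsetProd _ _).trans ((Finset.sum_le_sum fun i _ => h _ _).trans ?_)
    simp
  rcases Int.units_eq_one_or (Equiv.Perm.sign s) with hs | hs <;> simpa [hs] using hprod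

/-- For rows `S` and workers `A`, the spread matrix is surjective where a polynomial of bounded
degree does not vanish. -/
theorem exists_polynomial_spreadMatrix (𝔽 : Type) [Field 𝔽] {m r N Nr : ℕ} (S : Finset (Fin m))
    (A : Finset (Fin N)) (hS : S.card = r * Nr) (hA : A.card = Nr) (hNr : 1 ≤ Nr) (hNrN : Nr ≤ N) :
    ∃ p : MvPolynomial (Fin m × (Fin r × Fin N)) 𝔽, p ≠ 0 ∧ p.totalDegree ≤ Nr * (r * Nr) ∧
      ∀ g, eval g p ≠ 0 → Function.Surjective
        (spreadMatrix Nr A (of fun (i : S) x => g (i, x))).mulVec := by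
  classical
  have hS' : Fintype.card S = r * Nr := by simpa using hS
  let e := Fintype.equivOfCardEq (card_spreadMatrix_rows hS' hA hNr hNrN)
  let P : Matrix S (Fin r × Fin N) (MvPolynomial (Fin m × (Fin r × Fin N)) 𝔽) :=
    of fun i x => X (i.1, x)
  have hmap : ∀ {R : Type} [CommRing R] (f : MvPolynomial (Fin m × (Fin r × Fin N)) 𝔽 →+* R),
      f ((spreadMatrix Nr A P).submatrix e.symm id).det
        = ((spreadMatrix Nr A (P.map f)).submatrix e.symm id).det := by
    intro R _ f
    rw [RingHom.map_det, ← spreadMatrix_map]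
    rfl
  refine ⟨((spreadMatrix Nr A P).submatrix e.symm id).det, fun h0 => ?_, ?_, fun g hg => ?_⟩
  -- Substituting the entries of the special matrix `G` for the variables would make the determinant
  -- of its injective spread matrix zero.
  · obtain ⟨G, hG⟩ := exists_spreadMatrix_injective 𝔽 A hS' hA hNrN
    let g : Fin m × (Fin r × Fin N) → MvPolynomial (S × (Fin r × Fin N)) 𝔽 :=
      fun q => if h : q.1 ∈ S then G ⟨q.1, h⟩ q.2 else 0
    have hPG : P.map (eval₂Hom C g) = G := by
      ext1 i x
      simp [P, g]
    have h1 := hmap (eval₂Hom C g)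
    rw [h0, map_zero, hPG] at h1
    obtain ⟨v, hv, hv0⟩ := exists_mulVec_eq_zero_iff.2 h1.symm
    refine hv (hG v ?_)
    funext i
    have := congrFun hv0 (e i)
    simpa [mulVec, dotProduct] using this
  · refine (totalDegree_det_le _ fun i j => ?_).trans (by simp [hS, hA])
    simp only [submatrix_apply, id]
    rcases e.symm i with k | x <;> simp only [spreadMatrix] <;> split_ifs <;> simp [P]
  · have hP : P.map (eval g) = of fun (i : S) x => g (i, x) := by
      ext i x
      simp [P]
    rw [hmap, hP] at hg
    intro v
    obtain ⟨y, hy⟩ := (mulVec_surjective_iff_isUnit.2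
      ((isUnit_iff_isUnit_det _).2 (isUnit_iff_ne_zero.2 hg))) (fun q => v (e.symm q))
    refine ⟨y, funext fun i => ?_⟩
    have := congrFun hy (e i)
    simpa [mulVec, dotProduct] using this

/-- All entries are nonzero and, for any choice of `r * Nr` rows, any `Nr` workers have a
surjective spread matrix. -/
def IsGeneric {𝔽 : Type} [Field 𝔽] {m r N : ℕ} (Nr : ℕ) (g : Fin m × (Fin r × Fin N) → 𝔽) : Prop :=
  (∀ q, g q ≠ 0) ∧
    ∀ S : Finset (Fin m), S.card = r * Nr → ∀ A : Finset (Fin N), A.card = Nr →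
      Function.Surjective (spreadMatrix Nr A (of fun (i : S) x => g (i, x))).mulVec

/-- Schwartz-Zippel is applied to the product of the polynomials. -/
theorem card_not_forall_mul_card_le {𝔽 σ κ : Type} [Field 𝔽] [Finite 𝔽] [Finite σ] [Fintype κ]
    (Q : κ → (σ → 𝔽) → Prop) (d : ℕ)
    (h : ∀ k, ∃ p : MvPolynomial σ 𝔽, p ≠ 0 ∧ p.totalDegree ≤ d ∧ ∀ g, eval g p ≠ 0 → Q k g) :
    Nat.card {g // ¬ ∀ k, Q k g} * Nat.card 𝔽 ≤ Fintype.card κ * d * Nat.card (σ → 𝔽) := by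
  choose p hp hd hQ using h
  have hdeg : (∏ k, p k).totalDegree ≤ Fintype.card κ * d :=
    (totalDegree_finsetProd _ _).trans ((Finset.sum_le_sum fun k _ => hd k).trans (by simp))
  refine (Nat.mul_le_mul_right _ ?_).trans (card_eval_eq_zero_mul_card_le (∏ k, p k)
    (Finset.prod_ne_zero_iff.2 fun k _ => hp k) _ hdeg)
  refine Nat.card_le_card_of_injective (fun g => ⟨g.1, ?_⟩) fun g g' h =>
    Subtype.ext (by simpa using h)
  by_contra h0
  rw [map_prod, Finset.prod_eq_zero_iff] at h0
  exact g.2 fun k => hQ k _ fun hk => h0 ⟨k, Finset.mem_univ _, hk⟩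

theorem exists_card_not_isGeneric_le (m r N Nr : ℕ) (hNr : 1 ≤ Nr) (hNrN : Nr ≤ N) :
    ∃ C : ℕ, ∀ (𝔽 : Type) [Field 𝔽] [Finite 𝔽],
      Nat.card {g : Fin m × (Fin r × Fin N) → 𝔽 // ¬ IsGeneric Nr g} * Nat.card 𝔽
        ≤ C * Nat.card (Fin m × (Fin r × Fin N) → 𝔽) := by
  classical
  let κ := (Fin m × (Fin r × Fin N)) ⊕
    ({S : Finset (Fin m) // S.card = r * Nr} × {A : Finset (Fin N) // A.card = Nr})
  refine ⟨Fintype.card κ * (Nr * (r * Nr) + 1), fun 𝔽 _ _ => ?_⟩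
  let Q : κ → (Fin m × (Fin r × Fin N) → 𝔽) → Prop := fun k g => k.elim (fun q => g q ≠ 0)
    fun SA => Function.Surjective (spreadMatrix Nr SA.2.1 (of fun (i : SA.1.1) x => g (i, x))).mulVec
  have h := card_not_forall_mul_card_le Q (Nr * (r * Nr) + 1) (by
    rintro (q | ⟨⟨S, hS⟩, ⟨A, hA⟩⟩)
    · exact ⟨X q, X_ne_zero q, by simp, fun g hg => by simpa [Q] using hg⟩
    · obtain ⟨p, hp, hd, hQ⟩ := exists_polynomial_spreadMatrix 𝔽 S A hS hA hNr hNrN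
      exact ⟨p, hp, hd.trans (Nat.le_succ _), hQ⟩)
  convert h using 6 with g
  exact ⟨fun hg => by
    rintro (q | ⟨S, A⟩)
    · exact hg.1 q
    · exact hg.2 S.1 S.2 A.1 A.2,
    fun hg => ⟨fun q => hg (.inl q), fun S hS A hA => hg (.inr (⟨S, hS⟩, ⟨A, hA⟩))⟩⟩

/-! ### From genericity to the combinations sent by the workers -/

/-- If the spread matrices are surjective, then each worker can be given `r` combinations of the
rows of `G`, supported at its positions, such that those of any `Nr` workers span the rows. -/
theorem exists_cyclic_combinations {𝔽 : Type} [Field 𝔽] {ρ : Type} [DecidableEq ρ] [Fintype ρ]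
    {r N Nr : ℕ} (hρ : Fintype.card ρ = r * Nr) (hNr : 1 ≤ Nr) (hNrN : Nr ≤ N)
    (G : Matrix ρ (Fin r × Fin N) 𝔽)
    (hG : ∀ A : Finset (Fin N), A.card = Nr → Function.Surjective (spreadMatrix Nr A G).mulVec) :
    ∃ t : Fin N → Fin r → (Fin r × Fin N) → 𝔽,
      (∀ n j x, x.2 ∉ cyclicWindow N Nr n → t n j x = 0) ∧
      ∀ A : Finset (Fin N), A.card = Nr → ∀ w, (∀ n ∈ A, ∀ j, t n j ⬝ᵥ w = 0) → G *ᵥ w = 0 := by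
  let B : ∀ n : Fin N, Matrix {x : Fin r × Fin N // x.2 ∉ cyclicWindow N Nr n} ρ 𝔽 :=
    fun n => of fun x i => G i x
  have hB : ∀ n v x, (B n).mulVecLin v x = (v ᵥ* G) x := by
    intro n v x
    simp [B, mulVec, vecMul, dotProduct, mul_comm]
  -- The kernel consists of the coefficient vectors usable by worker `n`. Surjectivity of `B n`,
  -- read off the spread matrix of any `A` containing `n`, gives dimension `r * Nr - r * (Nr - 1)`.
  have hrank : ∀ n, Module.finrank 𝔽 (LinearMap.ker (B n).mulVecLin) = r := by
    intro n
    have hsurj : Function.Surjective (B n).mulVecLin := by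
      obtain ⟨A, hnA, -, hA⟩ := Finset.exists_subsuperset_card_eq
        (Finset.subset_univ {n}) (n := Nr) (by simpa using hNr) (by simpa using hNrN)
      intro v
      obtain ⟨y, hy⟩ := hG A hA (Sum.elim 0 fun x =>
        if h : x.1.1 = n then v ⟨x.2.1, h ▸ x.2.2⟩ else 0)
      refine ⟨fun i => y (⟨n, hnA (by simp)⟩, i), funext fun x => ?_⟩
      have := congrFun hy (.inr ⟨⟨n, hnA (by simp)⟩, x⟩)
      rw [spreadMatrix_mulVec_inr] at this
      simpa [B, mulVec, dotProduct] using this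
    have h := LinearMap.finrank_range_add_finrank_ker (B n).mulVecLin
    rw [LinearMap.range_eq_top.2 hsurj, finrank_top, Module.finrank_fintype_fun_eq_card,
      Module.finrank_fintype_fun_eq_card, card_uncovered hNr hNrN, hρ] at h
    obtain ⟨k, rfl⟩ : ∃ k, Nr = k + 1 := ⟨Nr - 1, by omega⟩
    rw [Nat.add_sub_cancel, Nat.mul_succ] at h
    omega
  let b := fun n => Module.finBasisOfFinrankEq 𝔽 _ (hrank n)
  refine ⟨fun n j => (b n j).1 ᵥ* G, fun n j x hx => ?_, fun A hA w hw => ?_⟩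
  · exact (hB n _ ⟨x, hx⟩).symm.trans (congrFun (LinearMap.mem_ker.1 (b n j).2) _)
  · have hker : ∀ n ∈ A, ∀ s ∈ LinearMap.ker (B n).mulVecLin, s ⬝ᵥ (G *ᵥ w) = 0 := by
      intro n hn s hs
      let ψ : (ρ → 𝔽) →ₗ[𝔽] 𝔽 := dotProductBilin 𝔽 𝔽 |>.flip (G *ᵥ w)
      have hψ : ψ ∘ₗ (LinearMap.ker (B n).mulVecLin).subtype = 0 := by
        refine (b n).ext fun j => ?_
        have := hw n hn j
        rw [← dotProduct_mulVec] at this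
        exact this
      exact LinearMap.congr_fun hψ ⟨s, hs⟩
    funext i
    -- This preimage writes the unit vector at `i` as a sum of kernel vectors of the workers in `A`.
    obtain ⟨y, hy⟩ := hG A hA (Sum.elim (Pi.single i 1) 0)
    have hsum : Pi.single i 1 = ∑ n : A, fun k => y (n, k) := by
      funext k
      have := congrFun hy (.inl k)
      rw [spreadMatrix_mulVec_inl] at this
      simpa using this.symm
    calc (G *ᵥ w) i = Pi.single i 1 ⬝ᵥ (G *ᵥ w) := by simp
      _ = ∑ n : A, (fun k => y (n, k)) ⬝ᵥ (G *ᵥ w) := by rw [hsum, sum_dotProduct]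
      _ = 0 := Finset.sum_eq_zero fun n _ => hker n n.2 _ (by
        rw [LinearMap.mem_ker]
        funext x
        have := congrFun hy (.inr ⟨n, x⟩)
        rw [spreadMatrix_mulVec_inr] at this
        simpa [B, mulVec, dotProduct] using this)

/-! ### Placement of the datasets -/

/-- Positions at distance at least `g` both ways round the cycle fall in different chunks of length
`g` counted from `n`. -/
theorem Fin.val_sub_div_ne {N g : ℕ} [NeZero N] (n p p' : Fin N) (hg : 0 < g)
    (h₁ : p.val + g ≤ p'.val) (h₂ : p'.val + g ≤ p.val + N) :
    (p - n).val / g ≠ (p' - n).val / g := by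
  intro h
  have e₁ := Nat.div_add_mod (p - n).val g
  have e₂ := Nat.div_add_mod (p' - n).val g
  have l₁ := Nat.mod_lt (p - n).val hg
  have l₂ := Nat.mod_lt (p' - n).val hg
  rw [h] at e₁
  rcases le_total (p - n).val (p' - n).val with hle | hle
  · have h3 := Fin.val_sub_eq_of_le n p p' hle
    rw [Fin.sub_val_of_le (by rw [Fin.le_def]; omega)] at h3
    omega
  · have h3 := Fin.val_sub_eq_of_le n p' p hle
    rw [Fin.val_sub, Nat.mod_eq_of_lt (by omega)] at h3
    omega

/-- The datasets are placed in `a + 1` blocks of `N` positions: `a` full blocks and a block where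
the last `b` datasets are at distance at least `N / b` from each other. -/
theorem exists_placement {K N Nr a b : ℕ} (hb : 0 < b) (hbN : b < N) (hK : K = a * N + b)
    (hNr : 1 ≤ Nr) (hNrN : Nr ≤ N) :
    ∃ pos : Fin K → Fin (a + 1) × Fin N, Function.Injective pos ∧
      ∀ n, (Finset.univ.filter fun k => (pos k).2 ∈ cyclicWindow N Nr n).card
        ≤ computationCost₁ N Nr a b := by
  have hN : 0 < N := by omega
  have : NeZero N := ⟨hN.ne'⟩
  set g := N / b with hgdef
  have hg : 0 < g := Nat.div_pos hbN.le hb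
  have hgb : b * g ≤ N := Nat.mul_div_le N b
  have hlast : ∀ c c', c < c' → c' < b → c * g + g ≤ c' * g ∧ c' * g + g ≤ N := by
    intro c c' h h'
    have h1 := Nat.mul_le_mul_right g (Nat.succ_le_of_lt h)
    have h2 := Nat.mul_le_mul_right g (Nat.succ_le_of_lt h')
    rw [Nat.succ_mul] at h1 h2
    exact ⟨h1, h2.trans hgb⟩
  have hlt : ∀ c, c < b → c * g < N := by
    intro c h
    have := (Nat.mul_lt_mul_right hg).2 h
    omega
  let pos : Fin K → Fin (a + 1) × Fin N := fun k =>
    if h : k.val < a * N then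
      (⟨k.val / N, ((Nat.div_lt_iff_lt_mul hN).2 h).trans (Nat.lt_succ_self a)⟩,
        ⟨k.val % N, Nat.mod_lt _ hN⟩)
    else (⟨a, Nat.lt_succ_self a⟩, ⟨(k.val - a * N) * g, hlt _ (by omega)⟩)
  have hfull : ∀ k : Fin K, k.val < a * N →
      (pos k).1.val = k.val / N ∧ (pos k).2.val = k.val % N := by
    intro k h
    simp [pos, h]
  have hrest : ∀ k : Fin K, ¬ k.val < a * N →
      (pos k).1.val = a ∧ (pos k).2.val = (k.val - a * N) * g := by
    intro k h
    simp [pos, h]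
  have hfull_lt : ∀ k : Fin K, k.val < a * N → (pos k).1.val < a := fun k h => by
    rw [(hfull k h).1]
    exact (Nat.div_lt_iff_lt_mul hN).2 h
  have hfull_inj : ∀ k k' : Fin K, k.val < a * N → k'.val < a * N → pos k = pos k' → k = k' := by
    intro k k' h h' hp
    obtain ⟨h1, h2⟩ := hfull k h
    obtain ⟨h3, h4⟩ := hfull k' h'
    rw [hp] at h1 h2
    rw [Fin.ext_iff, ← Nat.div_add_mod k.val N, ← Nat.div_add_mod k'.val N, ← h1, ← h2, h3, h4]
  have hrest_inj : ∀ n : Fin N, ∀ k k' : Fin K, ¬ k.val < a * N → ¬ k'.val < a * N →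
      ((pos k).2 - n).val / g = ((pos k').2 - n).val / g → k = k' := by
    intro n k k' h h' hd
    rcases lt_trichotomy (k.val - a * N) (k'.val - a * N) with hlt' | heq | hlt'
    · obtain ⟨h1, h2⟩ := hlast _ _ hlt' (by omega)
      refine absurd hd (Fin.val_sub_div_ne n _ _ hg ?_ ?_) <;>
        rw [(hrest k h).2, (hrest k' h').2] <;> omega
    · exact Fin.ext (by omega)
    · obtain ⟨h1, h2⟩ := hlast _ _ hlt' (by omega)
      refine absurd hd.symm (Fin.val_sub_div_ne n _ _ hg ?_ ?_) <;>
        rw [(hrest k h).2, (hrest k' h').2] <;> omega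
  refine ⟨pos, fun k k' hp => ?_, fun n => ?_⟩
  · by_cases h : k.val < a * N <;> by_cases h' : k'.val < a * N
    · exact hfull_inj k k' h h' hp
    · have := hfull_lt k h
      rw [hp, (hrest k' h').1] at this
      omega
    · have := hfull_lt k' h'
      rw [← hp, (hrest k h).1] at this
      omega
    · exact hrest_inj ⟨0, hN⟩ k k' h h' (by rw [hp])
  · rw [← Finset.card_filter_add_card_filter_not (fun k : Fin K => k.val < a * N)]
    refine Nat.add_le_add ?_ ?_
    · have hcard : (Finset.range a ×ˢ cyclicWindow N Nr n).card = a * (N - Nr + 1) := by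
        rw [Finset.card_product, Finset.card_range, card_cyclicWindow hNr hNrN]
      rw [← hcard]
      refine Finset.card_le_card_of_injOn (fun k => ((pos k).1.val, (pos k).2)) ?_ ?_
      · intro k hk
        simp only [Finset.coe_filter, Finset.mem_filter, Finset.mem_univ, true_and,
          Set.mem_ofPred_eq] at hk
        simp [hfull_lt k hk.2, hk.1]
      · intro k hk k' hk' h
        simp only [Finset.coe_filter, Finset.mem_filter, Finset.mem_univ, true_and,
          Set.mem_ofPred_eq] at hk hk'
        obtain ⟨h1, h2⟩ := Prod.mk.inj h
        exact hfull_inj k k' hk.2 hk'.2 (Prod.ext (Fin.ext h1) h2)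
    -- The window splits into this many chunks of length at most `g`, each with at most one of the
    -- last `b` datasets.
    · rw [← Finset.card_range ((N - Nr + 1) ⌈/⌉ g)]
      refine Finset.card_le_card_of_injOn (fun k => ((pos k).2 - n).val / g) ?_ ?_
      · intro k hk
        simp only [Finset.coe_filter, Finset.mem_filter, Finset.mem_univ, true_and,
          Set.mem_ofPred_eq, mem_cyclicWindow] at hk
        simp only [Finset.coe_range, Set.mem_Iio, Nat.ceilDiv_eq_add_pred_div]
        rw [Nat.lt_iff_add_one_le, ← Nat.add_div_right _ hg]
        exact Nat.div_le_div_right (by omega)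
      · intro k hk k' hk' h
        simp only [Finset.coe_filter, Finset.mem_filter, Finset.mem_univ, true_and,
          Set.mem_ofPred_eq] at hk hk'
        exact hrest_inj n k k' hk.2 hk'.2 h

/-! ### Computing the requests from generic matrices -/

/-- The datasets held by each worker when dataset `k` is placed at position `(pos k).2`. -/
def cyclicAssignment {K N r : ℕ} (Nr : ℕ) (pos : Fin K → Fin r × Fin N) (n : Fin N) :
    Finset (Fin K) :=
  Finset.univ.filter fun k => (pos k).2 ∈ cyclicWindow N Nr n

/-- Each position carries the sum of the entries of `v` placed there, so `pos` need not be
injective; gradient coding relies on this when it merges all blocks into one. -/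
theorem exists_cyclic_combinations_of_isGeneric {𝔽 : Type} [Field 𝔽] {K N Nr m r : ℕ}
    (hNr : 1 ≤ Nr) (hNrN : Nr ≤ N) (pos : Fin K → Fin r × Fin N)
    {g : Fin m × (Fin r × Fin N) → 𝔽} (hg : IsGeneric Nr g) (S : Finset (Fin m))
    (hS : S.card = r * Nr) :
    ∃ t : Fin N → Fin r → Fin K → 𝔽,
      (∀ n j k, k ∉ cyclicAssignment Nr pos n → t n j k = 0) ∧
      ∀ A : Finset (Fin N), A.card = Nr → ∀ v : Fin K → 𝔽,
        (∀ n ∈ A, ∀ j, ∑ k, t n j k * v k = 0) → ∀ i ∈ S, ∑ k, g (i, pos k) * v k = 0 := by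
  obtain ⟨t, ht₁, ht₂⟩ := exists_cyclic_combinations (ρ := S) (by simpa using hS) hNr hNrN
    (of fun (i : S) x => g (i, x)) (hg.2 S hS)
  refine ⟨fun n j k => t n j (pos k), fun n j k hk => ht₁ n j _ fun h => hk ?_,
    fun A hA v hv i hi => ?_⟩
  · simp [cyclicAssignment, h]
  · have hsum : ∀ u : Fin r × Fin N → 𝔽,
        u ⬝ᵥ (fun x => ∑ k, if pos k = x then v k else 0) = ∑ k, u (pos k) * v k := by
      intro u
      simp only [dotProduct, Finset.mul_sum]
      rw [Finset.sum_comm]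
      simp
    have h := congrFun (ht₂ A hA (fun x => ∑ k, if pos k = x then v k else 0)
      fun n hn j => (hsum _).trans (hv n hn j)) ⟨i, hi⟩
    exact (hsum _).symm.trans h

theorem card_subsets_containing (m d : ℕ) (hd : 1 ≤ d) (i : Fin m) :
    Fintype.card {S : {S : Finset (Fin m) // S.card = d} // i ∈ S.1} = (m - 1).choose (d - 1) := by
  have h := Finset.card_filter_powersetCard_subset {i} (Finset.univ : Finset (Fin m)) d (by simp)
    (by simpa using hd)
  rw [Finset.card_univ, Fintype.card_fin, Finset.card_singleton] at h
  rw [← h, ← Fintype.card_coe]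
  exact Fintype.card_congr
    ⟨fun S => ⟨S.1.1, by simp [S.1.2, S.2]⟩,
      fun S => ⟨⟨S.1, by have := S.2; simp at this; exact this.1⟩,
        by have := S.2; simp at this; exact this.2⟩, fun _ => rfl, fun _ => rfl⟩

/-- If the request matrix extends to a generic matrix with `m` rows, then `F * W` can be computed
from answers of `r * L'` symbols for each choice of `r * Nr` of these rows, where `L'` is the
length of the pieces of the messages. -/
theorem isLinearlyComputable_of_isGeneric {𝔽 : Type} [Field 𝔽] {K N Nr Kc m r L c L' : ℕ}
    (hr : 1 ≤ r) (hNr : 1 ≤ Nr) (hNrN : Nr ≤ N) (hm : Kc ≤ m) (pos : Fin K → Fin r × Fin N)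
    {g : Fin m × (Fin r × Fin N) → 𝔽} (hg : IsGeneric Nr g) (F : Matrix (Fin Kc) (Fin K) 𝔽)
    (hF : ∀ i k, g (Fin.castLE hm i, pos k) = F i k)
    (x : {S : Finset (Fin m) // S.card = r * Nr} → 𝔽) (hx : Function.Injective x)
    (e : Fin L ≃ Fin c × Fin L') (hc : (m - 1).choose (r * Nr - 1) = c) :
    IsLinearlyComputable Nr L (cyclicAssignment Nr pos)
      ({S : Finset (Fin m) // S.card = r * Nr} × Fin r × Fin L') F := by
  choose t ht₁ ht₂ using fun S : {S : Finset (Fin m) // S.card = r * Nr} =>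
    exists_cyclic_combinations_of_isGeneric hNr hNrN pos hg S.1 S.2
  -- Messages are cut into `c` pieces of length `L'`. For the row set `S`, the code acts on the
  -- combination of the pieces with coefficients the powers of `x S`.
  refine ⟨fun n =>
    { toFun := fun W q => ∑ k, t q.1 n q.2.1 k * ∑ u : Fin c, x q.1 ^ (u : ℕ) * W k (e.symm (u, q.2.2))
      map_add' := fun W W' => by
        funext q
        simp [mul_add, Finset.sum_add_distrib]
      map_smul' := fun a W => by
        funext q
        simp only [Matrix.smul_apply, smul_eq_mul, Pi.smul_apply, RingHom.id_apply, Finset.mul_sum]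
        exact Finset.sum_congr rfl fun k _ => Finset.sum_congr rfl fun u _ => by ring },
    fun n W hW => ?_, fun A hA W hW => ?_⟩
  · funext q
    change ∑ k, t q.1 n q.2.1 k * ∑ u : Fin c, x q.1 ^ (u : ℕ) * W k (e.symm (u, q.2.2)) = 0
    refine Finset.sum_eq_zero fun k _ => ?_
    by_cases hk : k ∈ cyclicAssignment Nr pos n
    · simp [hW k hk]
    · rw [ht₁ _ _ _ _ hk, zero_mul]
  · ext i l
    have hz : ∀ l', (fun u => ∑ k, F i k * W k (e.symm (u, l'))) = 0 := by
      intro l'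
      have hcard : Fintype.card (Fin c) = Fintype.card
          {S : {S : Finset (Fin m) // S.card = r * Nr} // Fin.castLE hm i ∈ S.1} := by
        rw [card_subsets_containing m _ (Nat.mul_pos hr hNr), hc, Fintype.card_fin]
      let E := Fintype.equivOfCardEq hcard
      -- Row `i` lies in exactly `c` of the sets `S`, which gives an invertible Vandermonde system
      -- for its values on the `c` pieces.
      refine eq_zero_of_forall_index_sum_pow_mul_eq_zero (f := fun s => x (E s).1)
        (hx.comp (Subtype.val_injective.comp E.injective)) fun s => ?_
      have h := ht₂ (E s).1 A hA (fun k => ∑ u : Fin c, x (E s).1 ^ (u : ℕ) * W k (e.symm (u, l')))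
        (fun n hn j => congrFun (hW n hn) ((E s).1, j, l')) _ (E s).2
      simp only [hF, Finset.mul_sum] at h ⊢
      rw [Finset.sum_comm] at h
      rw [← h]
      exact Finset.sum_congr rfl fun u _ => Finset.sum_congr rfl fun k _ => by ring
    have := congrFun (hz (e l).2) (e l).1
    simpa [mul_apply] using this

/-- Gradient coding: the entries of `F * W` can be computed from one symbol for each entry and each
worker. -/
theorem isLinearlyComputable_of_isGeneric_one {𝔽 : Type} [Field 𝔽] {K N Nr Kc r L : ℕ}
    (hNr : 1 ≤ Nr) (hNrN : Nr ≤ N) (pos : Fin K → Fin r × Fin N)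
    {g : Fin Nr × (Fin 1 × Fin N) → 𝔽} (hg : IsGeneric Nr g) (F : Matrix (Fin Kc) (Fin K) 𝔽) :
    IsLinearlyComputable Nr L (cyclicAssignment Nr pos) (Fin Kc × Fin L) F := by
  obtain ⟨t, ht₁, ht₂⟩ := exists_cyclic_combinations_of_isGeneric hNr hNrN
    (fun k => ((0 : Fin 1), (pos k).2)) hg Finset.univ (by simp)
  -- Rescaling turns row `0` of `g`, whose entries are nonzero, into the all-ones row; applied to `F
  -- i k * W k l`, it gives the entry of `F * W`.
  let c : Fin K → 𝔽 := fun k => (g (⟨0, hNr⟩, (0, (pos k).2)))⁻¹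
  refine ⟨fun n =>
    { toFun := fun W q => ∑ k, t n 0 k * (c k * F q.1 k * W k q.2)
      map_add' := fun W W' => by
        funext q
        simp [mul_add, Finset.sum_add_distrib]
      map_smul' := fun a W => by
        funext q
        simp only [Matrix.smul_apply, smul_eq_mul, Pi.smul_apply, RingHom.id_apply, Finset.mul_sum]
        exact Finset.sum_congr rfl fun k _ => by ring },
    fun n W hW => ?_, fun A hA W hW => ?_⟩
  · funext q
    change ∑ k, t n 0 k * (c k * F q.1 k * W k q.2) = 0
    refine Finset.sum_eq_zero fun k _ => ?_
    by_cases hk : k ∈ cyclicAssignment Nr pos n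
    · simp [hW k hk]
    · rw [ht₁ _ _ _ hk, zero_mul]
  · ext i l
    have h := ht₂ A hA (fun k => c k * F i k * W k l)
      (fun n hn j => by rw [Subsingleton.elim j 0]; exact congrFun (hW n hn) (i, l)) ⟨0, hNr⟩
      (Finset.mem_univ _)
    rw [mul_apply, Matrix.zero_apply, ← h]
    refine Finset.sum_congr rfl fun k _ => ?_
    have := hg.1 (⟨0, hNr⟩, (0, (pos k).2))
    simp only [c]
    field_simp

/-! ### Achievability in the three regimes -/

theorem card_matrix_subtype_mul_le {𝔽 α β : Type} [Finite 𝔽] [Finite α] [Finite β]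
    (P : Matrix α β 𝔽 → Prop) (q : ℕ) :
    Nat.card {F // P F} * q ≤ q * Nat.card (Matrix α β 𝔽) := by
  have : Finite (Matrix α β 𝔽) := inferInstanceAs (Finite (α → β → 𝔽))
  rw [mul_comm]
  exact Nat.mul_le_mul_left _ (Finite.card_subtype_le _)

theorem isAchievable_of_placement {K N Nr Kc r M L m c L' : ℕ} (hr : 1 ≤ r) (hNr : 1 ≤ Nr)
    (hNrN : Nr ≤ N) (hL : 0 < L) (hm : Kc ≤ m) (hrm : r * Nr ≤ m) (pos : Fin K → Fin r × Fin N)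
    (hpos : Function.Injective pos) (hM : ∀ n, (cyclicAssignment Nr pos n).card ≤ M)
    (hc : (m - 1).choose (r * Nr - 1) = c) (hcL : c * L' = L) :
    IsAchievable K N Nr Kc M L m := by
  classical
  obtain ⟨C, hC⟩ := exists_card_not_isGeneric_le m r N Nr hNr hNrN
  let s := Fintype.card {S : Finset (Fin m) // S.card = r * Nr}
  refine isAchievable_of_isLinearlyComputable (cyclicAssignment Nr pos) hM
    ({S : Finset (Fin m) // S.card = r * Nr} × Fin r × Fin L') m (C + s) hNrN hL ?_ fun 𝔽 _ _ => ?_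
  · rw [Fintype.card_prod, Fintype.card_prod, Fintype.card_fin, Fintype.card_fin,
      Fintype.card_finset_len, Fintype.card_fin, ← hcL, ← hc]
    have hD : 1 ≤ r * Nr := Nat.mul_pos hr hNr
    -- The total traffic is `m * L` because `m * (m-1).choose (d-1) = m.choose d * d` with `d = r *
    -- Nr`.
    have h := Nat.add_one_mul_choose_eq (m - 1) (r * Nr - 1)
    rw [Nat.sub_add_cancel (hD.trans hrm), Nat.sub_add_cancel hD] at h
    rw [← mul_assoc m, h]
    ring
  have : Fintype 𝔽 := Fintype.ofFinite 𝔽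
  -- Distinct Vandermonde nodes for all the sets need `s` field elements. In smaller fields the
  -- bound `(C + s) / q` exceeds `1` and is trivial.
  rcases le_or_gt s (Nat.card 𝔽) with hs | hs
  · obtain ⟨x⟩ : Nonempty ({S : Finset (Fin m) // S.card = r * Nr} ↪ 𝔽) :=
      Function.Embedding.nonempty_of_card_le (by rwa [← Nat.card_eq_fintype_card (α := 𝔽)])
    -- `F` fills part of the larger matrix; virtual rows and empty positions are free to be chosen
    -- so as to make it generic.
    let j : Fin Kc × Fin K → Fin m × (Fin r × Fin N) := Prod.map (Fin.castLE hm) pos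
    have hj : Function.Injective j := (Fin.castLE_injective hm).prodMap hpos
    have h := card_not_exists_extension_mul_le j hj (IsGeneric Nr) _ _ (hC 𝔽)
    rw [Nat.card_congr (Equiv.curry (Fin Kc) (Fin K) 𝔽)] at h
    refine (Nat.mul_le_mul_right _ ?_).trans
      (h.trans (Nat.mul_le_mul_right _ (Nat.le_add_right C s)))
    refine Nat.card_le_card_of_injective (fun F => ⟨fun q => F.1 q.1 q.2, ?_⟩) ?_
    · rintro ⟨g, hgF, hg⟩
      exact F.2 (isLinearlyComputable_of_isGeneric hr hNr hNrN hm pos hg F.1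
        (fun i k => congrFun hgF (i, k)) x x.injective
        ((finCongr hcL.symm).trans finProdFinEquiv.symm) hc)
    · intro F F' h
      refine Subtype.ext (Matrix.ext fun i k => ?_)
      exact congrFun (congrArg Subtype.val h) (i, k)
  · exact (Nat.mul_le_mul_left _ hs.le).trans ((card_matrix_subtype_mul_le _ s).trans
      (Nat.mul_le_mul_right _ (Nat.le_add_left s C)))

theorem isAchievable_mul_of_placement {K N Nr Kc r M L : ℕ} (hNr : 1 ≤ Nr)
    (hNrN : Nr ≤ N) (hL : 0 < L) (pos : Fin K → Fin r × Fin N)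
    (hM : ∀ n, (cyclicAssignment Nr pos n).card ≤ M) :
    IsAchievable K N Nr Kc M L ((Nr * Kc : ℕ) : ℚ) := by
  obtain ⟨C, hC⟩ := exists_card_not_isGeneric_le Nr 1 N Nr hNr hNrN
  refine isAchievable_of_isLinearlyComputable (cyclicAssignment Nr pos) hM (Fin Kc × Fin L)
    (Nr * Kc) C hNrN hL (by simp [mul_assoc]) fun 𝔽 _ _ => ?_
  -- The matrix `g` does not depend on `F`: if one exists no `F` is bad, and otherwise `q ≤ C` makes
  -- the bound trivial.
  by_cases hg : ∃ g : Fin Nr × (Fin 1 × Fin N) → 𝔽, IsGeneric Nr g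
  · obtain ⟨g, hg⟩ := hg
    have : IsEmpty {F : Matrix (Fin Kc) (Fin K) 𝔽 //
        ¬ IsLinearlyComputable Nr L (cyclicAssignment Nr pos) (Fin Kc × Fin L) F} :=
      ⟨fun F => F.2 (isLinearlyComputable_of_isGeneric_one hNr hNrN pos hg F.1)⟩
    simp
  · have h := hC 𝔽
    rw [Nat.card_congr (Equiv.subtypeUnivEquiv fun g hgen => hg ⟨g, hgen⟩), mul_comm] at h
    exact (Nat.mul_le_mul_left _ (Nat.le_of_mul_le_mul_right h Nat.card_pos)).trans
      (card_matrix_subtype_mul_le _ C)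

theorem theorem5 (K N Nr Kc a b L : ℕ) (hb : 0 < b) (hbN : b < N) (hK : K = a * N + b)
    (hNr : 1 ≤ Nr) (hNrN : Nr ≤ N) (hKc : 1 ≤ Kc) (hKcK : Kc ≤ K) (hL : 0 < L) :
    (Kc ≤ K / N →
      IsAchievable K N Nr Kc (computationCost₁ N Nr a b) L ((Nr * Kc : ℕ) : ℚ)) ∧
    (K ⌈/⌉ N ≤ Kc → Kc ≤ (K ⌈/⌉ N) * Nr →
      IsAchievable K N Nr Kc (computationCost₁ N Nr a b) L (((K ⌈/⌉ N) * Nr : ℕ) : ℚ)) ∧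
    ((K ⌈/⌉ N) * Nr < Kc → (Kc - 1).choose ((K ⌈/⌉ N) * Nr - 1) ∣ L →
      IsAchievable K N Nr Kc (computationCost₁ N Nr a b) L (Kc : ℚ)) := by
  have hceil : K ⌈/⌉ N = a + 1 := by
    rw [Nat.ceilDiv_eq_add_pred_div, hK,
      show a * N + b + N - 1 = (b - 1) + N * (a + 1) by rw [Nat.mul_succ, mul_comm N]; omega,
      Nat.add_mul_div_left _ _ (by omega), Nat.div_eq_of_lt (by omega), zero_add]
  rw [hceil]
  obtain ⟨pos, hpos, hM⟩ := exists_placement hb hbN hK hNr hNrN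
  refine ⟨fun _ => isAchievable_mul_of_placement hNr hNrN hL pos hM, fun _ h => ?_,
    fun h hdvd => ?_⟩
  -- Here `m = (a + 1) * Nr`: there is a single row set, and messages are not cut.
  · exact isAchievable_of_placement (Nat.le_add_left 1 a) hNr hNrN hL h le_rfl pos hpos hM
      (Nat.choose_self _) (one_mul L)
  · obtain ⟨L', rfl⟩ := hdvd
    exact isAchievable_of_placement (Nat.le_add_left 1 a) hNr hNrN hL le_rfl h.le pos hpos hM rfl
      rfl
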